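/- For a permutation $\pi\in S_n$ let $c_1(\pi)$ denote the number of $1$-cycles (fixed points) of $\pi$, and for an integer $k\ge 0$ let $\sigma_k(q)=\sum_{d\mid q}d^k$. Let $q\in\mathbb{N}$ be sufficiently large, let $\Delta\geq 1$ be an integer with $\Delta\leq \frac{\log q}{\log 2}$, and let $n\geq \Delta q$ be an integer. Then $$ \frac{1}{n!}\sum_{\pi\in S_n}\binom{c_1(\pi^q)}{\Delta}= \begin{cases} \sigma_0(q)&\text{if }\Delta=1,\\ \frac{1}{2}\sigma_1(q)+\mathcal{O}\left(\sigma_0(q)^2\right) &\text{if }\Delta=2,\\ \frac{1}{6}\sigma_2(q)+\mathcal{O}\left(\sigma_0(q)\sigma_1(q)\right) &\text{if }\Delta=3,\\ \frac{1}{\Delta!}\sigma_{\Delta-1}(q)+\mathcal{O}\left(\frac{1}{\Delta!}q^{\Delta-2}\left(\Delta\sigma_0(q)+2^{\Delta}\right)\right) &\text{if }\Delta\geq 4. \end{cases} $$ The $\mathcal{O}$-constant is universal: there are an absolute constant $C>0$ and an absolute $q_0$ such that for all $q\ge q_0$ and all $\Delta$, $n$ as above, each error term is at most $C$ times the expression inside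 $\mathcal{O}(\cdot)$ in absolute value. -/

import Mathlib

open scoped Nat

/-- `cycleCount i π` is `c_i(π)`, the number of `i`-cycles of the permutation `π` of
`{1, …, n}`. Here `π.partition` is the full cycle type of `π`, in which every fixed point
contributes a part equal to `1`; so `c_1(π)` is the number of fixed points. -/
def cycleCount {n : ℕ} (i : ℕ) (π : Equiv.Perm (Fin n)) : ℕ :=
  π.partition.parts.count i

/-- The average over `π ∈ S_n` of `binom(c_1(π ^ q), Δ)`. -/
noncomputable def meanChoose (n q Δ : ℕ) : ℝ :=
  (1 / (n ! : ℝ)) * ∑ π : Equiv.Perm (Fin n), ((cycleCount 1 (π ^ q)).choose Δ : ℝ)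

/-! A `d`-cycle of `π` contributes `d` fixed points to `π ^ q` if `d ∣ q` and none otherwise, so `X
= c_1(π ^ q)` equals `∑ d ∣ q, d * c_d(π)`. Marking and removing a `d`-cycle turns an average over
`S_n` weighted by `d * c_d` into an average over `S_{n-d}` (`partitionMean_mul_count`). Applied to
`(Δ + 1) * binom(X, Δ + 1) = X * binom(X - 1, Δ)`, this gives a recurrence showing that the mean
does not depend on `n` once `n ≥ Δ * q`.

For the stable factorial moments `M_k` it reads `M_{k+1} = ∑_{j ≤ k} binom(k, j) A_j M_{k-j}`, with
`A_j = ∑ d ∣ q, (d-1)⋯(d-j)`. The term `j = k` is `A_k`, which is `σ_k(q)` up to lower order. With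
`v_k = M_{k+1} / q^k` and `c_j = A_j / q^j`, the remaining terms give `q (v_k - c_k) = ∑_{j < k}
binom(k, j) c_j v_{k-1-j}`.

For `j ≥ 2`, `c_j` is below a constant exceeding `ζ(2)`. An induction using `2^(k+1) ≤ q` bounds
`v_k` as well (`scaledMoment_le`). The sum is then `O(k σ_0(q) + 2^k)`: the end terms, involving
`c_0, c_1, v_0, v_1`, give the first part, up to `O(2^k)`, and the binomial sum gives the second. -/

/-! ### Fixed points of a power of a permutation -/

/-- The sum of the parts of `m` that divide `q`. -/
def dvdSum (q : ℕ) (m : Multiset ℕ) : ℕ :=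
  (m.map fun d => if d ∣ q then d else 0).sum

theorem dvdSum_cons {q d : ℕ} (hd : d ∣ q) (m : Multiset ℕ) :
    dvdSum q (d ::ₘ m) = dvdSum q m + d := by
  simp [dvdSum, hd, add_comm]

theorem dvdSum_eq_sum_divisors {q : ℕ} (hq : q ≠ 0) (m : Multiset ℕ) :
    dvdSum q m = ∑ d ∈ q.divisors, d * m.count d := by
  induction m using Multiset.induction_on with
  | empty => simp [dvdSum]
  | cons a m ih =>
    simp only [dvdSum, Multiset.map_cons, Multiset.sum_cons] at ih ⊢
    rw [ih]
    simp only [Multiset.count_cons, mul_add, Finset.sum_add_distrib, mul_ite, mul_one, mul_zero,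
      Finset.sum_ite_eq', Nat.mem_divisors, hq, ne_eq, not_false_eq_true, and_true]
    ring

namespace Equiv.Perm

theorem dvdSum_cycleType_add_card_support_pow {α : Type*} [Fintype α] [DecidableEq α]
    (q : ℕ) (σ : Equiv.Perm α) :
    dvdSum q σ.cycleType + (σ ^ q).support.card = σ.support.card := by
  induction σ using cycle_induction_on with
  | base_one => simp [dvdSum]
  | base_cycles σ hσ =>
    have hon : σ.IsCycleOn σ.support := by
      rw [Equiv.Perm.coe_support_eq_set_support]
      exact hσ.isCycleOn
    rw [hσ.cycleType]
    by_cases h : σ.support.card ∣ q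
    · have : σ ^ q = 1 := by
        rw [← orderOf_dvd_iff_pow_eq_one, hσ.orderOf]; exact h
      simp [dvdSum, h, this]
    -- A power of a cycle fixing one point of its support has exponent divisible by the length.
    · have : (σ ^ q).support = σ.support := by
        refine (support_pow_le σ q).antisymm fun x hx => ?_
        rw [mem_support]
        intro hx'
        exact h ((hon.pow_apply_eq hx).1 hx')
      simp [dvdSum, h, this]
  | induction_disjoint σ τ hd _ hσ hτ =>
    rw [hd.cycleType_mul, hd.card_support_mul, hd.commute.mul_pow,
      (hd.pow_disjoint_pow q q).card_support_mul, ← hσ, ← hτ]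
    simp only [dvdSum, Multiset.map_add, Multiset.sum_add]
    ring

end Equiv.Perm

theorem cycleCount_one_pow {n : ℕ} (q : ℕ) (π : Equiv.Perm (Fin n)) :
    cycleCount 1 (π ^ q) = dvdSum q π.partition.parts := by
  have h := π.dvdSum_cycleType_add_card_support_pow q
  have hle : π.support.card ≤ Fintype.card (Fin n) := Finset.card_le_univ _
  have h1 : (π ^ q).cycleType.count 1 = 0 :=
    Multiset.count_eq_zero.2 fun h => absurd (Equiv.Perm.one_lt_of_mem_cycleType h) (by simp)
  rw [cycleCount, Equiv.Perm.parts_partition, Equiv.Perm.parts_partition, Multiset.count_add, h1,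
    Multiset.count_replicate_self]
  simp only [dvdSum, Multiset.map_add, Multiset.sum_add, Multiset.map_replicate,
    Multiset.sum_replicate, one_dvd, if_true, smul_eq_mul, mul_one] at h ⊢
  omega

/-! ### Averages of functions of the cycle type -/

/-- The order of the centralizer of a permutation whose cycle lengths, with fixed points
counted as cycles of length one, are the entries of `m`. -/
def centralizerCard (m : Multiset ℕ) : ℕ :=
  m.prod * ∏ i ∈ m.toFinset, (m.count i)!

theorem prod_factorial_count_eq {m : Multiset ℕ} {s : Finset ℕ} (h : m.toFinset ⊆ s) :
    ∏ i ∈ m.toFinset, (m.count i)! = ∏ i ∈ s, (m.count i)! := by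
  refine Finset.prod_subset h fun i _ hi => ?_
  rw [Multiset.mem_toFinset, ← Multiset.count_eq_zero] at hi
  simp [hi]

/-- The new factor is exactly the weight `d * c_d` of the enlarged multiset; this cancellation is
what makes removing a marked cycle work. -/
theorem centralizerCard_cons (d : ℕ) (m : Multiset ℕ) :
    centralizerCard (d ::ₘ m) = d * (m.count d + 1) * centralizerCard m := by
  have hs : m.toFinset ⊆ insert d m.toFinset := Finset.subset_insert _ _
  rw [centralizerCard, centralizerCard, Multiset.prod_cons, Multiset.toFinset_cons,
    prod_factorial_count_eq hs, ← Finset.mul_prod_erase _ _ (Finset.mem_insert_self d _),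
    ← Finset.mul_prod_erase _ (fun i => (m.count i)!) (Finset.mem_insert_self d _),
    Multiset.count_cons_self, Nat.factorial_succ]
  have : ∀ i ∈ (insert d m.toFinset).erase d, ((d ::ₘ m).count i)! = (m.count i)! := by
    intro i hi
    rw [Multiset.count_cons_of_ne (Finset.ne_of_mem_erase hi)]
  rw [Finset.prod_congr rfl this]
  ring

theorem centralizerCard_pos {m : Multiset ℕ} (hm : ∀ i ∈ m, 0 < i) : 0 < centralizerCard m := by
  refine Nat.mul_pos (Multiset.prod_pos hm) (Finset.prod_pos fun i _ => Nat.factorial_pos _)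

theorem card_partition_parts_eq_mul_centralizerCard {n : ℕ} (p : n.Partition) :
    (Finset.univ.filter fun π : Equiv.Perm (Fin n) => π.partition.parts = p.parts).card *
      centralizerCard p.parts = n ! := by
  set m := p.parts.filter (2 ≤ ·) with hm
  have hsplit : p.parts = m + Multiset.replicate (p.parts.count 1) 1 := by
    rw [← Multiset.filter_eq', hm]
    conv_lhs => rw [← Multiset.filter_add_not (2 ≤ ·) p.parts]
    congr 1
    refine Multiset.filter_congr fun i hi => ?_
    have := p.parts_pos hi
    omega
  have hsum : m.sum + p.parts.count 1 = n := by
    conv_rhs => rw [← p.parts_sum, hsplit]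
    simp
  have hfilter : (Finset.univ.filter fun π : Equiv.Perm (Fin n) => π.partition.parts = p.parts) =
      Finset.univ.filter fun π : Equiv.Perm (Fin n) => π.cycleType = m := by
    refine Finset.filter_congr fun π _ => ⟨fun h => ?_, fun h => ?_⟩
    · rw [← Equiv.Perm.filter_parts_partition_eq_cycleType, h]
    · rw [Equiv.Perm.parts_partition, ← Equiv.Perm.sum_cycleType, h, hsplit]
      congr 2
      simp only [Fintype.card_fin]
      omega
  have hm2 : ∀ a ∈ m, 2 ≤ a := fun a ha => (Multiset.mem_filter.1 ha).2
  have hcount : ∀ i ∈ m.toFinset, m.count i = p.parts.count i := by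
    intro i hi
    exact Multiset.count_filter_of_pos (hm2 i (Multiset.mem_toFinset.1 hi))
  have hone : 1 ∉ m.toFinset := fun h => absurd (hm2 1 (Multiset.mem_toFinset.1 h)) (by simp)
  have hsub : p.parts.toFinset ⊆ insert 1 m.toFinset := by
    intro i hi
    rw [Multiset.mem_toFinset, hsplit, Multiset.mem_add, Multiset.mem_replicate] at hi
    rw [Finset.mem_insert, Multiset.mem_toFinset]
    tauto
  have hz : centralizerCard p.parts =
      (n - m.sum)! * m.prod * ∏ i ∈ m.toFinset, (m.count i)! := by
    have hprod : p.parts.prod = m.prod := by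
      rw [hsplit]; simp
    rw [centralizerCard, prod_factorial_count_eq hsub, Finset.prod_insert hone, hprod,
      ← Finset.prod_congr rfl (fun i hi => congrArg Nat.factorial (hcount i hi)),
      show n - m.sum = p.parts.count 1 by omega]
    ring
  have hcard := Equiv.Perm.card_of_cycleType_mul_eq (Fin n) m
  rw [Fintype.card_fin, if_pos ⟨by omega, hm2⟩] at hcard
  rw [hfilter, hz]
  exact hcard

/-- The average of `g` over the cycle types of the permutations of `n` letters. -/
noncomputable def partitionMean (n : ℕ) (g : Multiset ℕ → ℝ) : ℝ :=
  ∑ p : n.Partition, g p.parts / centralizerCard p.parts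

theorem mean_perm_eq_partitionMean (n : ℕ) (g : Multiset ℕ → ℝ) :
    (1 / (n ! : ℝ)) * ∑ π : Equiv.Perm (Fin n), g π.partition.parts = partitionMean n g := by
  let f : Equiv.Perm (Fin n) → n.Partition := fun π =>
    ⟨π.partition.parts, π.partition.parts_pos, by simpa using π.partition.parts_sum⟩
  rw [partitionMean, Finset.mul_sum, ← Finset.sum_fiberwise Finset.univ f]
  refine Finset.sum_congr rfl fun p _ => ?_
  have hp := card_partition_parts_eq_mul_centralizerCard p
  have hz : (centralizerCard p.parts : ℝ) ≠ 0 := by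
    exact_mod_cast (centralizerCard_pos fun i hi => p.parts_pos hi).ne'
  have hn : (n ! : ℝ) ≠ 0 := by exact_mod_cast n.factorial_ne_zero
  have hf : (Finset.univ.filter fun π => f π = p) =
      Finset.univ.filter fun π : Equiv.Perm (Fin n) => π.partition.parts = p.parts :=
    Finset.filter_congr fun π _ => Nat.Partition.ext_iff
  rw [hf, Finset.sum_congr rfl (g := fun _ => 1 / (n ! : ℝ) * g p.parts)
    (fun π hπ => by rw [(Finset.mem_filter.1 hπ).2]), Finset.sum_const, nsmul_eq_mul]
  rw [← hp]
  push_cast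
  have hc : ((Finset.univ.filter fun π : Equiv.Perm (Fin n) =>
      π.partition.parts = p.parts).card : ℝ) ≠ 0 := by
    intro h
    rw [← hp, Nat.cast_mul, h, zero_mul] at hn
    exact hn rfl
  field_simp

theorem partitionMean_one (n : ℕ) : partitionMean n (fun _ => 1) = 1 := by
  rw [← mean_perm_eq_partitionMean]
  have hn : (n ! : ℝ) ≠ 0 := by exact_mod_cast n.factorial_ne_zero
  simp [Fintype.card_perm, hn]

/-- Marking a cycle of length `d` and removing it. -/
theorem partitionMean_mul_count {n d : ℕ} (hd : 1 ≤ d) (hdn : d ≤ n) (g : Multiset ℕ → ℝ) :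
    partitionMean n (fun m => ((d * m.count d : ℕ) : ℝ) * g m) =
      partitionMean (n - d) (fun m => g (d ::ₘ m)) := by
  set F : n.Partition → ℝ := fun p =>
    ((d * p.parts.count d : ℕ) : ℝ) * g p.parts / centralizerCard p.parts with hF
  have h1 : ∑ x : {p : n.Partition // d ∈ p.parts}, F x.1 = ∑ p : n.Partition, F p := by
    rw [← Finset.sum_subtype (Finset.univ.filter fun p : n.Partition => d ∈ p.parts)
      (by simp) F]
    refine Finset.sum_subset (Finset.subset_univ _) fun p _ hp => ?_
    have : p.parts.count d = 0 := Multiset.count_eq_zero.2 fun h => hp (by simpa using h)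
    simp [hF, this]
  change ∑ p : n.Partition, F p = _
  rw [← h1, ← (Nat.Partition.partitionWithPartEquiv hd hdn).symm.sum_comp, partitionMean]
  refine Finset.sum_congr rfl fun p _ => ?_
  have hz : (centralizerCard p.parts : ℝ) ≠ 0 := by
    exact_mod_cast (centralizerCard_pos fun i hi => p.parts_pos hi).ne'
  have hd0 : (d : ℝ) ≠ 0 := by positivity
  have hc : ((p.parts.count d : ℝ) + 1) ≠ 0 := by positivity
  simp only [hF, Nat.Partition.partitionWithPartEquiv_symm_apply_parts, Multiset.count_cons_self,
    centralizerCard_cons]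
  push_cast
  field_simp

theorem meanChoose_eq_partitionMean (n q Δ : ℕ) :
    meanChoose n q Δ = partitionMean n (fun m => ((dvdSum q m).choose Δ : ℝ)) := by
  rw [← mean_perm_eq_partitionMean, meanChoose]
  simp only [cycleCount_one_pow]

theorem meanChoose_zero (n q : ℕ) : meanChoose n q 0 = 1 := by
  simp [meanChoose_eq_partitionMean, partitionMean_one]

/-- One of the `X` fixed points is singled out and the cycle of `π` containing it, of length `d ∣
q`, is removed. The other `Δ` chosen points split between that cycle and the rest. -/
theorem meanChoose_succ {n q Δ : ℕ} (hq : q ≠ 0) (hn : q ≤ n) :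
    (Δ + 1 : ℝ) * meanChoose n q (Δ + 1) =
      ∑ d ∈ q.divisors, ∑ ij ∈ Finset.HasAntidiagonal.antidiagonal Δ,
        ((d - 1).choose ij.2 : ℝ) * meanChoose (n - d) q ij.1 := by
  have hpt : ∀ m : Multiset ℕ, ((Δ : ℝ) + 1) * ((dvdSum q m).choose (Δ + 1) : ℝ) =
      ∑ d ∈ q.divisors, ((d * m.count d : ℕ) : ℝ) * ((dvdSum q m - 1).choose Δ : ℝ) := by
    intro m
    rw [← Finset.sum_mul, ← Nat.cast_sum, ← dvdSum_eq_sum_divisors hq]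
    -- At `X = 0` the subtraction `X - 1` truncates, but both sides vanish.
    rcases Nat.eq_zero_or_pos (dvdSum q m) with h | h
    · simp [h]
    · obtain ⟨k, hk⟩ := Nat.exists_eq_add_of_lt h
      have := Nat.add_one_mul_choose_eq k Δ
      simp only [zero_add] at hk
      rw [hk, Nat.add_sub_cancel, mul_comm]
      exact_mod_cast this.symm
  have hsum : (Δ + 1 : ℝ) * meanChoose n q (Δ + 1) = ∑ d ∈ q.divisors,
      partitionMean n (fun m => ((d * m.count d : ℕ) : ℝ) * ((dvdSum q m - 1).choose Δ : ℝ)) := by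
    simp only [meanChoose_eq_partitionMean, partitionMean]
    rw [Finset.mul_sum, Finset.sum_comm]
    refine Finset.sum_congr rfl fun p _ => ?_
    rw [← mul_div_assoc, hpt, Finset.sum_div]
  rw [hsum]
  refine Finset.sum_congr rfl fun d hd => ?_
  have hdq := Nat.dvd_of_mem_divisors hd
  have hd1 : 1 ≤ d := Nat.pos_of_mem_divisors hd
  rw [partitionMean_mul_count hd1 ((Nat.le_of_dvd (Nat.pos_of_ne_zero hq) hdq).trans hn)
    (fun m => ((dvdSum q m - 1).choose Δ : ℝ))]
  simp only [meanChoose_eq_partitionMean, partitionMean, Finset.mul_sum]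
  rw [Finset.sum_comm]
  refine Finset.sum_congr rfl fun p _ => ?_
  -- Vandermonde for `X' + (d - 1)`, where `X'` is the value after removal.
  rw [dvdSum_cons hdq, Nat.add_sub_assoc hd1, Nat.add_choose_eq, Nat.cast_sum, Finset.sum_div]
  refine Finset.sum_congr rfl fun ij _ => ?_
  push_cast
  ring

theorem meanChoose_eq_of_le {q : ℕ} (hq : q ≠ 0) (Δ : ℕ) :
    ∀ {n n' : ℕ}, Δ * q ≤ n → Δ * q ≤ n' → meanChoose n q Δ = meanChoose n' q Δ := by
  induction Δ using Nat.strong_induction_on with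
  | _ Δ ih =>
    intro n n' hn hn'
    obtain _ | Δ := Δ
    · rw [meanChoose_zero, meanChoose_zero]
    have hne : ((Δ : ℝ) + 1) ≠ 0 := by positivity
    refine mul_left_cancel₀ hne ?_
    rw [add_mul, one_mul] at hn hn'
    rw [meanChoose_succ hq (le_of_add_le_right hn), meanChoose_succ hq (le_of_add_le_right hn')]
    refine Finset.sum_congr rfl fun d hd => Finset.sum_congr rfl fun ij hij => ?_
    have hdq := Nat.le_of_dvd (Nat.pos_of_ne_zero hq) (Nat.dvd_of_mem_divisors hd)
    have hi : ij.1 + ij.2 = Δ := Finset.HasAntidiagonal.mem_antidiagonal.1 hij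
    have hiq : ij.1 * q ≤ Δ * q := Nat.mul_le_mul_right q (by omega)
    rw [ih ij.1 (by omega) (n := n - d) (n' := n' - d) (by omega) (by omega)]

/-! ### The factorial moments -/

/-- The stable value of the `k`-th factorial moment of the number of fixed points of `π ^ q`. -/
noncomputable def stableMoment (q k : ℕ) : ℝ :=
  (k ! : ℝ) * meanChoose (k * q) q k

/-- The sum of `(d - 1)(d - 2)⋯(d - j)` over the divisors `d` of `q`. -/
def divisorDescSum (q j : ℕ) : ℕ :=
  ∑ d ∈ q.divisors, (d - 1).descFactorial j

theorem meanChoose_eq_stableMoment {n q k : ℕ} (hq : q ≠ 0) (hn : k * q ≤ n) :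
    meanChoose n q k = stableMoment q k / (k ! : ℝ) := by
  have : (k ! : ℝ) ≠ 0 := by exact_mod_cast k.factorial_ne_zero
  rw [stableMoment, mul_div_cancel_left₀ _ this, meanChoose_eq_of_le hq k hn le_rfl]

theorem stableMoment_zero (q : ℕ) : stableMoment q 0 = 1 := by
  simp [stableMoment, meanChoose_zero]

theorem stableMoment_nonneg (q k : ℕ) : 0 ≤ stableMoment q k := by
  unfold stableMoment meanChoose
  positivity

theorem stableMoment_succ {q : ℕ} (hq : q ≠ 0) (k : ℕ) :
    stableMoment q (k + 1) = ∑ j ∈ Finset.range (k + 1),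
      (k.choose j : ℝ) * divisorDescSum q j * stableMoment q (k - j) := by
  have hsucc := meanChoose_succ (Δ := k) hq
    (show q ≤ (k + 1) * q from Nat.le_mul_of_pos_left q k.succ_pos)
  rw [stableMoment, Nat.factorial_succ, Nat.cast_mul, mul_comm ((k + 1 : ℕ) : ℝ), mul_assoc,
    Nat.cast_succ, hsucc, Finset.sum_comm, Finset.Nat.sum_antidiagonal_eq_sum_range_succ_mk,
    ← Finset.sum_range_reflect, Finset.mul_sum]
  refine Finset.sum_congr rfl fun j hj => ?_
  have hjk : j ≤ k := Nat.lt_succ_iff.1 (Finset.mem_range.1 hj)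
  have e1 : k + 1 - 1 - j = k - j := by omega
  have e2 : k - (k - j) = j := by omega
  rw [e1, divisorDescSum, Nat.cast_sum, Finset.mul_sum, Finset.mul_sum, Finset.sum_mul]
  refine Finset.sum_congr rfl fun d hd => ?_
  have hdq := Nat.le_of_dvd (Nat.pos_of_ne_zero hq) (Nat.dvd_of_mem_divisors hd)
  have hle : (k - j) * q ≤ (k + 1) * q - d := by
    have : (k - j) * q ≤ k * q := Nat.mul_le_mul_right q (Nat.sub_le k j)
    rw [add_mul, one_mul]
    omega
  rw [meanChoose_eq_stableMoment hq hle, e2, Nat.descFactorial_eq_factorial_mul_choose,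
    ← Nat.choose_mul_factorial_mul_factorial hjk]
  have h1 : ((k - j)! : ℝ) ≠ 0 := by exact_mod_cast (k - j).factorial_ne_zero
  push_cast
  field_simp

/-! ### Estimates for sums over divisors -/

/-- The sum of `(d / q) ^ j` over the divisors `d` of `q`. -/
noncomputable def divisorRatioSum (q j : ℕ) : ℝ :=
  ∑ d ∈ q.divisors, ((d : ℝ) / q) ^ j

theorem sigma_eq_pow_mul_divisorRatioSum {q : ℕ} (hq : q ≠ 0) (j : ℕ) :
    (ArithmeticFunction.sigma j q : ℝ) = (q : ℝ) ^ j * divisorRatioSum q j := by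
  have : (q : ℝ) ≠ 0 := by exact_mod_cast hq
  rw [ArithmeticFunction.sigma_apply, divisorRatioSum, Finset.mul_sum, Nat.cast_sum]
  refine Finset.sum_congr rfl fun d _ => ?_
  rw [div_pow, mul_div_cancel₀ _ (pow_ne_zero _ this), Nat.cast_pow]

theorem divisorRatioSum_zero (q : ℕ) : divisorRatioSum q 0 = q.divisors.card := by
  simp [divisorRatioSum]

theorem divisorRatioSum_nonneg (q j : ℕ) : 0 ≤ divisorRatioSum q j :=
  Finset.sum_nonneg fun _ _ => by positivity

theorem divisorRatioSum_antitone (q : ℕ) : Antitone (divisorRatioSum q) := by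
  intro i j hij
  refine Finset.sum_le_sum fun d hd => pow_le_pow_of_le_one (by positivity) ?_ hij
  exact div_le_one_of_le₀ (by exact_mod_cast Nat.divisor_le hd) (by positivity)

theorem one_le_divisorRatioSum {q : ℕ} (hq : q ≠ 0) (j : ℕ) : 1 ≤ divisorRatioSum q j := by
  have h := Finset.single_le_sum (f := fun d : ℕ => ((d : ℝ) / q) ^ j) (s := q.divisors)
    (fun _ _ => by positivity) (Nat.mem_divisors_self q hq)
  have : (q : ℝ) ≠ 0 := by exact_mod_cast hq
  simpa [divisorRatioSum, div_self this] using h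

/-- The substitution `d ↦ q / d` produces a partial sum of `ζ(2) = π² / 6 < 7 / 4`. That `7 / 4 < 2`
is needed to close the induction in `scaledMoment_le`. -/
theorem divisorRatioSum_two_le (q : ℕ) : divisorRatioSum q 2 ≤ 7 / 4 := by
  have h1 : divisorRatioSum q 2 = ∑ d ∈ q.divisors, 1 / (d : ℝ) ^ 2 := by
    rw [divisorRatioSum, ← Nat.sum_div_divisors q (fun d => 1 / (d : ℝ) ^ 2)]
    refine Finset.sum_congr rfl fun d hd => ?_
    rw [Nat.cast_div (Nat.dvd_of_mem_divisors hd)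
      (by exact_mod_cast (Nat.pos_of_mem_divisors hd).ne')]
    simp [div_pow]
  have h2 := sum_le_hasSum q.divisors (fun i _ => by positivity) hasSum_zeta_two
  rw [h1]
  refine h2.trans ?_
  have := Real.pi_lt_d2
  have := Real.pi_pos
  nlinarith

theorem divisorRatioSum_le {q j : ℕ} (hj : 2 ≤ j) : divisorRatioSum q j ≤ 7 / 4 :=
  (divisorRatioSum_antitone q hj).trans (divisorRatioSum_two_le q)

theorem divisorRatioSum_one_sq_le (q : ℕ) :
    divisorRatioSum q 1 ^ 2 ≤ 7 / 4 * q.divisors.card := by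
  have h := sq_sum_le_card_mul_sum_sq (s := q.divisors) (f := fun d : ℕ => (d : ℝ) / q)
  have h2 := divisorRatioSum_two_le q
  simp only [divisorRatioSum, pow_one] at h2 ⊢
  have : (0 : ℝ) ≤ q.divisors.card := by positivity
  nlinarith

/-- In each pair `d, q / d` one member is at most `√q`. -/
theorem card_divisors_sq_le (q : ℕ) : q.divisors.card ^ 2 ≤ 4 * q := by
  rcases Nat.eq_zero_or_pos q with rfl | hq
  · simp
  have hsub : q.divisors ⊆
      Finset.Icc 1 q.sqrt ∪ (Finset.Icc 1 q.sqrt).image (fun d => q / d) := by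
    intro d hd
    have hdvd := Nat.dvd_of_mem_divisors hd
    have hd0 := Nat.pos_of_mem_divisors hd
    obtain ⟨e, rfl⟩ := hdvd
    have he0 : 0 < e := Nat.pos_of_mul_pos_left hq
    simp only [Finset.mem_union, Finset.mem_Icc, Finset.mem_image]
    rcases le_total d e with h | h
    · exact Or.inl ⟨hd0, Nat.le_sqrt.2 (Nat.mul_le_mul_left d h)⟩
    · exact Or.inr ⟨e, ⟨he0, Nat.le_sqrt.2 (Nat.mul_le_mul_right e h)⟩,
        Nat.mul_div_cancel d he0⟩
  have hcard : q.divisors.card ≤ 2 * q.sqrt := by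
    refine (Finset.card_le_card hsub).trans ((Finset.card_union_le _ _).trans ?_)
    have := Finset.card_image_le (s := Finset.Icc 1 q.sqrt) (f := fun d => q / d)
    simp only [Nat.card_Icc] at this ⊢
    omega
  have := Nat.sqrt_le' q
  nlinarith

/-- Each new factor differs from `d` by at most `k + 2`, and `(k + 1)^2 + (k + 2) ≤ (k + 2)^2`.
Truncated subtraction keeps this valid for small `d`. -/
theorem pow_le_descFactorial_add (d k : ℕ) :
    d ^ (k + 1) ≤ (d - 1).descFactorial (k + 1) + (k + 1) ^ 2 * d ^ k := by
  induction k with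
  | zero => simp; omega
  | succ k ih =>
    set P := (d - 1).descFactorial (k + 1) with hP
    have hPle : P ≤ d ^ (k + 1) :=
      (Nat.descFactorial_le_pow _ _).trans (Nat.pow_le_pow_left (Nat.sub_le d 1) _)
    have hsplit : d * P ≤ (d - 1 - (k + 1)) * P + (k + 2) * P := by
      rw [← add_mul]
      exact Nat.mul_le_mul_right P (by omega)
    rw [Nat.descFactorial_succ, ← hP]
    calc d ^ (k + 1 + 1) = d * d ^ (k + 1) := by ring
      _ ≤ d * (P + (k + 1) ^ 2 * d ^ k) := Nat.mul_le_mul_left d ih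
      _ = d * P + (k + 1) ^ 2 * d ^ (k + 1) := by ring
      _ ≤ (d - 1 - (k + 1)) * P + (k + 2) * d ^ (k + 1) + (k + 1) ^ 2 * d ^ (k + 1) := by
        have := Nat.mul_le_mul_left (k + 2) hPle
        omega
      _ ≤ (d - 1 - (k + 1)) * P + (k + 1 + 1) ^ 2 * d ^ (k + 1) := by
        have : 0 ≤ k * d ^ (k + 1) := Nat.zero_le _
        nlinarith

theorem divisorDescSum_zero (q : ℕ) : divisorDescSum q 0 = q.divisors.card := by
  simp [divisorDescSum]

theorem divisorDescSum_div_le (q j : ℕ) :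
    (divisorDescSum q j : ℝ) / (q : ℝ) ^ j ≤ divisorRatioSum q j := by
  rw [divisorDescSum, divisorRatioSum, Nat.cast_sum, Finset.sum_div]
  refine Finset.sum_le_sum fun d _ => ?_
  rw [div_pow]
  gcongr
  exact_mod_cast (Nat.descFactorial_le_pow _ _).trans (Nat.pow_le_pow_left (Nat.sub_le d 1) _)

theorem divisorRatioSum_sub_le {q : ℕ} (hq : q ≠ 0) (k : ℕ) :
    (q : ℝ) * (divisorRatioSum q (k + 1) - divisorDescSum q (k + 1) / (q : ℝ) ^ (k + 1)) ≤
      ((k : ℝ) + 1) ^ 2 * divisorRatioSum q k := by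
  have hq0 : (0 : ℝ) < q := by exact_mod_cast Nat.pos_of_ne_zero hq
  rw [divisorDescSum, divisorRatioSum, divisorRatioSum, Nat.cast_sum, Finset.sum_div,
    ← Finset.sum_sub_distrib, Finset.mul_sum, Finset.mul_sum]
  refine Finset.sum_le_sum fun d _ => ?_
  have h : (d : ℝ) ^ (k + 1) ≤ (d - 1).descFactorial (k + 1) + ((k : ℝ) + 1) ^ 2 * (d : ℝ) ^ k := by
    exact_mod_cast pow_le_descFactorial_add d k
  rw [div_pow, div_pow, ← sub_div, pow_succ (q : ℝ) k, mul_div_assoc', mul_comm (q : ℝ) (_ - _),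
    mul_div_mul_right _ _ hq0.ne', mul_div_assoc']
  gcongr
  linarith

/-! ### The recurrence for the normalised factorial moments -/

theorem sq_le_two_mul_two_pow (k : ℕ) : k ^ 2 ≤ 2 * 2 ^ k := by
  induction k with
  | zero => simp
  | succ k ih =>
    rcases lt_or_ge k 3 with h | h
    · interval_cases k <;> norm_num
    · rw [pow_succ 2 k]; nlinarith

theorem cube_le_four_mul_two_pow (k : ℕ) : k ^ 3 ≤ 4 * 2 ^ k := by
  induction k with
  | zero => simp
  | succ k ih =>
    rcases lt_or_ge k 4 with h | h
    · interval_cases k <;> norm_num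
    · have h2 : 16 * k ≤ k ^ 3 := by nlinarith [Nat.mul_le_mul h h]
      have h3 : 4 * k ^ 2 ≤ k ^ 3 := by nlinarith [Nat.zero_le (k ^ 2)]
      rw [pow_succ 2 k]
      nlinarith

/-- If `x` is of order at most `q ^ (1 / 3)` and `D` of order at most `q ^ (1 / 2)`, then `x * D` is
small compared with `q`. -/
theorem mul_le_of_cube_le_of_sq_le {q D x : ℝ} (hq : 4096 * 100 ^ 6 ≤ q)
    (hD : D ^ 2 ≤ 4 * q) (hx0 : 0 ≤ x) (hx : x ^ 3 ≤ 4 * q) : 100 * (x * D) ≤ q := by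
  by_contra hcon
  rw [not_le] at hcon
  have hq0 : 0 < q := lt_of_lt_of_le (by norm_num) hq
  have h1 : q ^ 6 < (100 * (x * D)) ^ 6 := pow_lt_pow_left₀ hcon hq0.le (by norm_num)
  have h2 : (x ^ 3) ^ 2 ≤ (4 * q) ^ 2 := pow_le_pow_left₀ (by positivity) hx 2
  have h3 : (D ^ 2) ^ 3 ≤ (4 * q) ^ 3 := pow_le_pow_left₀ (by positivity) hD 3
  have h4 : (100 * (x * D)) ^ 6 ≤ 100 ^ 6 * ((4 * q) ^ 2 * (4 * q) ^ 3) := by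
    calc (100 * (x * D)) ^ 6 = 100 ^ 6 * ((x ^ 3) ^ 2 * (D ^ 2) ^ 3) := by ring
      _ ≤ _ := by gcongr
  -- The bound in `h4` is `4^5 * 100^6 * q^5`, and `4^5 = 1024 < 4096`.
  have h5 : 4096 * 100 ^ 6 * q ^ 5 ≤ q ^ 6 := by
    calc 4096 * 100 ^ 6 * q ^ 5 ≤ q * q ^ 5 := by gcongr
      _ = q ^ 6 := by ring
  have h6 : 0 < q ^ 5 := by positivity
  nlinarith

/-- The sum that drives the recurrence for the normalised factorial moments. -/
theorem recurrence_sum_le {c v : ℕ → ℝ} {D s U : ℝ} {k : ℕ} (hk : 3 ≤ k)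
    (hc : ∀ j, 0 ≤ c j) (hv : ∀ j, 0 ≤ v j) (hc0 : c 0 = D) (hc1 : c 1 ≤ s)
    (hc2 : ∀ j, 2 ≤ j → c j ≤ 7 / 4) (hv0 : v 0 = D) (hv1 : v 1 ≤ s + 4)
    (hvU : ∀ j, 2 ≤ j → j < k → v j ≤ U) (hU : 0 ≤ U) (hD : 1 ≤ D) (hsD : s ≤ D)
    (hs : s ^ 2 ≤ 7 / 4 * D) :
    ∑ j ∈ Finset.range k, (k.choose j : ℝ) * c j * v (k - 1 - j) ≤
      (2 * U + 10) * (k * D) + (7 / 4 * U + 15) * 2 ^ k := by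
  have hs0 : 0 ≤ s := (hc 1).trans hc1
  have hk0 : (0 : ℝ) ≤ k := k.cast_nonneg
  have hk1 : (1 : ℝ) ≤ k := by exact_mod_cast (by omega : 1 ≤ k)
  have hkD : D ≤ k * D := le_mul_of_one_le_left (by linarith) hk1
  have hk2 : (k : ℝ) ^ 2 ≤ 2 * 2 ^ k := by exact_mod_cast sq_le_two_mul_two_pow k
  have hk3 : (k : ℝ) ^ 3 ≤ 4 * 2 ^ k := by exact_mod_cast cube_le_four_mul_two_pow k
  have htwo : (0 : ℝ) < 2 ^ k := by positivity
  have hUtwo : 0 ≤ U * 2 ^ k := by positivity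
  -- For `k = 3` the indices `1` and `k - 2` coincide, so the four end terms are not distinct.
  obtain rfl | hk4 := hk.eq_or_lt
  · simp only [Finset.sum_range_succ, Finset.sum_range_zero]
    norm_num [Nat.choose]
    have a0 : c 0 * v 2 ≤ D * U := by
      rw [hc0]; exact mul_le_mul_of_nonneg_left (hvU 2 le_rfl (by norm_num)) (by linarith)
    have a1 : c 1 * v 1 ≤ s * (s + 4) := mul_le_mul hc1 hv1 (hv 1) hs0
    have a2 : c 2 * v 0 ≤ 7 / 4 * D := by
      rw [hv0]; exact mul_le_mul_of_nonneg_right (hc2 2 le_rfl) (by linarith)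
    nlinarith
  · obtain ⟨m, rfl⟩ : ∃ m, k = m + 4 := ⟨k - 4, by omega⟩
    set K : ℕ := m + 4 with hK
    have hmid : ∑ j ∈ Finset.range m, (K.choose (j + 2) : ℝ) * c (j + 2) * v (K - 1 - (j + 2)) ≤
        7 / 4 * U * 2 ^ K := by
      calc _ ≤ ∑ j ∈ Finset.range m, (K.choose (j + 2) : ℝ) * (7 / 4 * U) := by
            refine Finset.sum_le_sum fun j hj => ?_
            have hjm := Finset.mem_range.1 hj
            rw [mul_assoc]
            refine mul_le_mul_of_nonneg_left ?_ (by positivity)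
            exact mul_le_mul (hc2 _ (by omega)) (hvU _ (by omega) (by omega)) (hv _) (by norm_num)
        _ = (∑ j ∈ Finset.range m, (K.choose (j + 2) : ℝ)) * (7 / 4 * U) :=
            (Finset.sum_mul _ _ _).symm
        _ ≤ 2 ^ K * (7 / 4 * U) := by
            refine mul_le_mul_of_nonneg_right ?_ (by positivity)
            have h := Nat.sum_range_choose K
            rw [hK, show m + 4 + 1 = m + 2 + 1 + 1 + 1 by ring, Finset.sum_range_succ,
              Finset.sum_range_succ' _ (m + 2 + 1), Finset.sum_range_succ' _ (m + 2),
              Finset.sum_range_succ, Finset.sum_range_succ] at h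
            have : ∑ j ∈ Finset.range m, K.choose (j + 2) ≤ 2 ^ K := by
              rw [← h]
              simp only [add_assoc, hK]
              norm_num
            exact_mod_cast this
        _ = _ := by ring
    have hch1 : K.choose (m + 2 + 1) = K := by
      rw [Nat.choose_symm_of_eq_add (show K = (m + 2 + 1) + 1 by omega), Nat.choose_one_right]
    have hch2 : (K.choose (m + 2) : ℝ) ≤ (K : ℝ) ^ 2 / 2 := by
      rw [Nat.choose_symm_of_eq_add (show K = (m + 2) + 2 by omega), Nat.cast_choose_two]
      nlinarith
    rw [show Finset.range K = Finset.range (m + 1 + 1 + 1 + 1) from rfl,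
      Finset.sum_range_succ, Finset.sum_range_succ, Finset.sum_range_succ', Finset.sum_range_succ']
    have b0 : (K.choose 0 : ℝ) * c 0 * v (K - 1 - 0) ≤ D * U := by
      rw [hc0, Nat.choose_zero_right, Nat.cast_one, one_mul]
      exact mul_le_mul_of_nonneg_left (hvU _ (by omega) (by omega)) (by linarith)
    have b1 : (K.choose (0 + 1) : ℝ) * c (0 + 1) * v (K - 1 - (0 + 1)) ≤ K * D * U := by
      rw [zero_add, Nat.choose_one_right]
      refine mul_le_mul ?_ (hvU _ (by omega) (by omega)) (hv _) (by positivity)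
      exact mul_le_mul_of_nonneg_left (hc1.trans hsD) hk0
    have b2 : (K.choose (m + 2) : ℝ) * c (m + 2) * v (K - 1 - (m + 2)) ≤
        (K : ℝ) ^ 2 / 2 * (7 / 4) * (s + 4) := by
      rw [show K - 1 - (m + 2) = 1 by omega]
      exact mul_le_mul (mul_le_mul hch2 (hc2 _ (by omega)) (hc _) (by positivity)) hv1 (hv 1)
        (by positivity)
    have b3 : (K.choose (m + 2 + 1) : ℝ) * c (m + 2 + 1) * v (K - 1 - (m + 2 + 1)) ≤
        K * (7 / 4) * D := by
      rw [show K - 1 - (m + 2 + 1) = 0 by omega, hch1, hv0]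
      exact mul_le_mul_of_nonneg_right
        (mul_le_mul_of_nonneg_left (hc2 _ (by omega)) hk0) (by linarith)
    -- AM-GM in the form `2 K² s ≤ K s² + K³` splits the mixed term between the two allowed errors.
    have hKs : (K : ℝ) ^ 2 * s ≤ 7 / 8 * (K * D) + 2 * 2 ^ K := by
      have h1 : 0 ≤ (K : ℝ) * (s - K) ^ 2 := by positivity
      have h2 : (K : ℝ) * s ^ 2 ≤ K * (7 / 4 * D) := mul_le_mul_of_nonneg_left hs hk0
      nlinarith
    have hDU : D * U ≤ K * D * U := mul_le_mul_of_nonneg_right hkD hU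
    have e : ∀ j, j + 1 + 1 = j + 2 := fun j => rfl
    simp only [e] at hmid ⊢
    nlinarith

/-! ### The main estimate -/

/-- The `(k + 1)`-st stable factorial moment, divided by `q ^ k`. -/
noncomputable def scaledMoment (q k : ℕ) : ℝ :=
  stableMoment q (k + 1) / (q : ℝ) ^ k

/-- `divisorDescSum q j`, divided by `q ^ j`. -/
noncomputable def scaledDescSum (q j : ℕ) : ℝ :=
  divisorDescSum q j / (q : ℝ) ^ j

theorem scaledMoment_nonneg (q k : ℕ) : 0 ≤ scaledMoment q k :=
  div_nonneg (stableMoment_nonneg _ _) (by positivity)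

theorem scaledDescSum_nonneg (q j : ℕ) : 0 ≤ scaledDescSum q j := by
  unfold scaledDescSum
  positivity

theorem scaledDescSum_zero (q : ℕ) : scaledDescSum q 0 = q.divisors.card := by
  simp [scaledDescSum, divisorDescSum_zero]

theorem mul_scaledMoment_sub {q : ℕ} (hq : q ≠ 0) (k : ℕ) :
    (q : ℝ) * (scaledMoment q k - scaledDescSum q k) = ∑ j ∈ Finset.range k,
      (k.choose j : ℝ) * scaledDescSum q j * scaledMoment q (k - 1 - j) := by
  have hq0 : (q : ℝ) ≠ 0 := by exact_mod_cast hq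
  rw [scaledMoment, scaledDescSum, stableMoment_succ hq, Finset.sum_range_succ, Nat.choose_self,
    Nat.sub_self, stableMoment_zero, Nat.cast_one, one_mul, mul_one, add_div, add_sub_cancel_right,
    Finset.sum_div, Finset.mul_sum]
  refine Finset.sum_congr rfl fun j hj => ?_
  have hjk := Finset.mem_range.1 hj
  obtain ⟨i, rfl⟩ : ∃ i, k = j + i + 1 := ⟨k - j - 1, by omega⟩
  rw [scaledMoment, scaledDescSum, show j + i + 1 - 1 - j = i by omega,
    show j + i + 1 - j = i + 1 by omega]
  field_simp
  ring

theorem scaledMoment_zero {q : ℕ} (hq : q ≠ 0) : scaledMoment q 0 = q.divisors.card := by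
  have hq0 : (q : ℝ) ≠ 0 := by exact_mod_cast hq
  have h := mul_scaledMoment_sub hq 0
  simp only [Finset.range_zero, Finset.sum_empty, mul_eq_zero, hq0, false_or] at h
  rw [sub_eq_zero.1 h, scaledDescSum_zero]

theorem card_divisors_sq_le_real (q : ℕ) : (q.divisors.card : ℝ) ^ 2 ≤ 4 * q := by
  exact_mod_cast card_divisors_sq_le q

theorem scaledMoment_one {q : ℕ} (hq : q ≠ 0) :
    q * (scaledMoment q 1 - scaledDescSum q 1) = (q.divisors.card : ℝ) ^ 2 := by
  rw [mul_scaledMoment_sub hq 1]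
  simp [scaledDescSum_zero, scaledMoment_zero hq, pow_two]

theorem mul_scaledMoment_two_sub {q : ℕ} (hq : q ≠ 0) :
    q * (scaledMoment q 2 - scaledDescSum q 2) =
      q.divisors.card * scaledMoment q 1 + 2 * scaledDescSum q 1 * q.divisors.card := by
  rw [mul_scaledMoment_sub hq 2]
  simp [Finset.sum_range_succ, scaledDescSum_zero, scaledMoment_zero hq]

theorem scaledMoment_one_le {q : ℕ} (hq : q ≠ 0) :
    scaledMoment q 1 ≤ divisorRatioSum q 1 + 4 := by
  have hq0 : (0 : ℝ) < q := by exact_mod_cast Nat.pos_of_ne_zero hq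
  have h := scaledMoment_one hq
  have hD := card_divisors_sq_le_real q
  have hc : scaledDescSum q 1 ≤ _ := divisorDescSum_div_le q 1
  have : scaledMoment q 1 - scaledDescSum q 1 ≤ 4 := by
    refine le_of_mul_le_mul_left ?_ hq0
    linarith
  linarith

theorem one_le_card_divisors {q : ℕ} (hq : q ≠ 0) : (1 : ℝ) ≤ q.divisors.card := by
  rw [← divisorRatioSum_zero]
  exact one_le_divisorRatioSum hq 0

theorem divisorRatioSum_one_le (q : ℕ) : divisorRatioSum q 1 ≤ q.divisors.card := by
  rw [← divisorRatioSum_zero]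
  exact divisorRatioSum_antitone q zero_le_one

theorem scaledMoment_two_le {q : ℕ} (hq : q ≠ 0) : scaledMoment q 2 ≤ 100 := by
  have hq0 : (0 : ℝ) < q := by exact_mod_cast Nat.pos_of_ne_zero hq
  have h := mul_scaledMoment_two_sub hq
  have hD := card_divisors_sq_le_real q
  have hD1 := one_le_card_divisors hq
  have h1 := scaledMoment_one_le hq
  have hs := divisorRatioSum_one_le q
  have hc : scaledDescSum q 1 ≤ _ := divisorDescSum_div_le q 1
  have hc2 : scaledDescSum q 2 ≤ _ := divisorDescSum_div_le q 2
  have h2 := divisorRatioSum_two_le q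
  have : scaledMoment q 2 - scaledDescSum q 2 ≤ 50 := by
    refine le_of_mul_le_mul_left ?_ hq0
    rw [h]
    nlinarith
  linarith

theorem mul_scaledMoment_sub_le {q k : ℕ} {U : ℝ} (hq : q ≠ 0) (hk : 3 ≤ k) (hU : 0 ≤ U)
    (hvU : ∀ j, 2 ≤ j → j < k → scaledMoment q j ≤ U) :
    (q : ℝ) * (scaledMoment q k - scaledDescSum q k) ≤
      (2 * U + 10) * (k * q.divisors.card) + (7 / 4 * U + 15) * 2 ^ k := by
  rw [mul_scaledMoment_sub hq]
  exact recurrence_sum_le hk (scaledDescSum_nonneg q) (scaledMoment_nonneg q)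
    (scaledDescSum_zero q) (divisorDescSum_div_le q 1)
    (fun j hj => (divisorDescSum_div_le q j).trans (divisorRatioSum_le hj))
    (scaledMoment_zero hq) (scaledMoment_one_le hq) hvU hU (one_le_card_divisors hq)
    (divisorRatioSum_one_le q) (divisorRatioSum_one_sq_le q)

/-- With `U = 200` the recurrence gives `410 * k * σ_0(q) + 365 * 2^k`. The first term is at most
`4.1 * q` and, since `2 * 2^k ≤ q`, the second at most `182.5 * q`, so the bound `200` reproduces
itself. -/
theorem scaledMoment_le {q k : ℕ} (hq : 4096 * 100 ^ 6 ≤ q) (hk : 2 ≤ k)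
    (hkq : 2 ^ (k + 1) ≤ q) : scaledMoment q k ≤ 200 := by
  have hqne : q ≠ 0 := by omega
  have hq0 : (0 : ℝ) < q := by exact_mod_cast Nat.pos_of_ne_zero hqne
  induction k using Nat.strong_induction_on with
  | _ k ih =>
    obtain rfl | hk3 := hk.eq_or_lt
    · exact (scaledMoment_two_le hqne).trans (by norm_num)
    have hstep := mul_scaledMoment_sub_le (U := 200) hqne hk3 (by norm_num) fun j hj hjk =>
      ih j hjk hj ((Nat.pow_le_pow_right two_pos (by omega)).trans hkq)
    have hck : scaledDescSum q k ≤ 7 / 4 := (divisorDescSum_div_le q k).trans (divisorRatioSum_le hk)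
    have hkq' : 2 * (2 : ℝ) ^ k ≤ q := by
      rw [← pow_succ']; exact_mod_cast hkq
    have hk3' : (k : ℝ) ^ 3 ≤ 4 * q := by
      have : (k : ℝ) ^ 3 ≤ 4 * 2 ^ k := by exact_mod_cast cube_le_four_mul_two_pow k
      have : (0 : ℝ) < 2 ^ k := by positivity
      linarith
    have hkD := mul_le_of_cube_le_of_sq_le (by exact_mod_cast hq) (card_divisors_sq_le_real q)
      k.cast_nonneg hk3'
    have : scaledMoment q k - scaledDescSum q k ≤ 198 := by
      refine le_of_mul_le_mul_left ?_ hq0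
      linarith
    linarith

theorem abs_scaledMoment_sub_le {q k : ℕ} (hq : 4096 * 100 ^ 6 ≤ q) (hk : 3 ≤ k)
    (hkq : 2 ^ (k + 1) ≤ q) :
    (q : ℝ) * |scaledMoment q k - divisorRatioSum q k| ≤
      1000 * (((k : ℝ) + 1) * q.divisors.card + 2 ^ (k + 1)) := by
  have hqne : q ≠ 0 := by omega
  have hq0 : (0 : ℝ) < q := by exact_mod_cast Nat.pos_of_ne_zero hqne
  have hstep := mul_scaledMoment_sub_le (U := 200) hqne hk (by norm_num) fun j hj hjk =>
    scaledMoment_le hq hj ((Nat.pow_le_pow_right two_pos (by omega)).trans hkq)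
  have hpos : 0 ≤ (q : ℝ) * (scaledMoment q k - scaledDescSum q k) := by
    rw [mul_scaledMoment_sub hqne]
    exact Finset.sum_nonneg fun j _ => mul_nonneg
      (mul_nonneg (Nat.cast_nonneg _) (scaledDescSum_nonneg q j)) (scaledMoment_nonneg q _)
  have hcS : scaledDescSum q k ≤ divisorRatioSum q k := divisorDescSum_div_le q k
  -- The error is a difference of two nonnegative quantities, `v_k - c_k` (recurrence) and
  -- `divisorRatioSum q k - c_k` (powers against falling factorials), each bounded separately.
  obtain ⟨m, rfl⟩ : ∃ m, k = m + 1 := ⟨k - 1, by omega⟩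
  have hsub : (q : ℝ) * (divisorRatioSum q (m + 1) - scaledDescSum q (m + 1)) ≤ _ :=
    divisorRatioSum_sub_le hqne m
  have hm : divisorRatioSum q m ≤ 7 / 4 := divisorRatioSum_le (by omega)
  have hk2 : ((m : ℝ) + 1) ^ 2 ≤ 2 * 2 ^ (m + 1) := by
    exact_mod_cast sq_le_two_mul_two_pow (m + 1)
  have hm2 : ((m : ℝ) + 1) ^ 2 * divisorRatioSum q m ≤ 2 * 2 ^ (m + 1) * (7 / 4) :=
    mul_le_mul hk2 hm (divisorRatioSum_nonneg q m) (by positivity)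
  have hD := one_le_card_divisors hqne
  have hmD : 0 ≤ (m : ℝ) * q.divisors.card := by positivity
  have hsub0 : 0 ≤ (q : ℝ) * (divisorRatioSum q (m + 1) - scaledDescSum q (m + 1)) :=
    mul_nonneg hq0.le (sub_nonneg.2 hcS)
  have htwo : (0 : ℝ) < 2 ^ (m + 1) := by positivity
  rw [← Nat.abs_cast, ← abs_mul, abs_le, pow_succ (2 : ℝ) (m + 1)]
  push_cast at hstep ⊢
  constructor <;> nlinarith

/-! ### The four cases of the theorem -/

theorem meanChoose_one {n q : ℕ} (hq : q ≠ 0) (hn : 1 * q ≤ n) :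
    meanChoose n q 1 = (ArithmeticFunction.sigma 0 q : ℝ) := by
  have h := scaledMoment_zero hq
  rw [meanChoose_eq_stableMoment hq hn, ArithmeticFunction.sigma_zero_apply, ← h]
  simp [scaledMoment]

theorem meanChoose_succ_eq_scaledMoment {n q k : ℕ} (hq : q ≠ 0) (hn : (k + 1) * q ≤ n) :
    meanChoose n q (k + 1) = (q : ℝ) ^ k * scaledMoment q k / ((k + 1)! : ℝ) := by
  have : (q : ℝ) ≠ 0 := by exact_mod_cast hq
  rw [meanChoose_eq_stableMoment hq hn, scaledMoment, mul_div_cancel₀ _ (pow_ne_zero _ this)]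

theorem meanChoose_two {n q : ℕ} (hq : q ≠ 0) (hn : 2 * q ≤ n) :
    |meanChoose n q 2 - 1 / 2 * (ArithmeticFunction.sigma 1 q : ℝ)| ≤
      (ArithmeticFunction.sigma 0 q : ℝ) ^ 2 := by
  have hq0 : (0 : ℝ) < q := by exact_mod_cast Nat.pos_of_ne_zero hq
  have h1 := scaledMoment_one hq
  have hsub : (q : ℝ) * (divisorRatioSum q 1 - scaledDescSum q 1) ≤ _ :=
    divisorRatioSum_sub_le hq 0
  have hcS : scaledDescSum q 1 ≤ divisorRatioSum q 1 := divisorDescSum_div_le q 1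
  have hsub0 := mul_nonneg hq0.le (sub_nonneg.2 hcS)
  have hD := one_le_card_divisors hq
  rw [meanChoose_succ_eq_scaledMoment (k := 1) hq hn, sigma_eq_pow_mul_divisorRatioSum hq,
    ArithmeticFunction.sigma_zero_apply, abs_le]
  rw [divisorRatioSum_zero] at hsub
  norm_num at hsub ⊢
  constructor <;> nlinarith

theorem meanChoose_three {n q : ℕ} (hq : q ≠ 0) (hn : 3 * q ≤ n) :
    |meanChoose n q 3 - 1 / 6 * (ArithmeticFunction.sigma 2 q : ℝ)| ≤
      2 * ((ArithmeticFunction.sigma 0 q : ℝ) * (ArithmeticFunction.sigma 1 q : ℝ)) := by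
  have hq0 : (0 : ℝ) < q := by exact_mod_cast Nat.pos_of_ne_zero hq
  have h2 := mul_scaledMoment_two_sub hq
  have h1 := scaledMoment_one_le hq
  have hsub : (q : ℝ) * (divisorRatioSum q 2 - scaledDescSum q 2) ≤ _ :=
    divisorRatioSum_sub_le hq 1
  have hcS : scaledDescSum q 2 ≤ divisorRatioSum q 2 := divisorDescSum_div_le q 2
  have hcS1 : scaledDescSum q 1 ≤ divisorRatioSum q 1 := divisorDescSum_div_le q 1
  have hsub0 := mul_nonneg hq0.le (sub_nonneg.2 hcS)
  have hD := one_le_card_divisors hq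
  have hS := one_le_divisorRatioSum hq 1
  have hc0 := scaledDescSum_nonneg q 1
  have hv0 := scaledMoment_nonneg q 1
  set D : ℝ := (q.divisors.card : ℝ) with hDdef
  set S := divisorRatioSum q 1
  have hDS : S ≤ D * S := le_mul_of_one_le_left (by linarith) hD
  have hup : D * scaledMoment q 1 + 2 * scaledDescSum q 1 * D ≤ 7 * (D * S) := by
    nlinarith
  have hlow : 0 ≤ D * scaledMoment q 1 + 2 * scaledDescSum q 1 * D := by positivity
  -- Here `11 = 7 + 4`: `7` from `hup`, and `4 = 2^2` from passing to falling factorials. Later `11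
  -- / 6 ≤ 2`.
  have hbound : |q * (scaledMoment q 2 - divisorRatioSum q 2)| ≤ 11 * (D * S) := by
    norm_num at hsub
    rw [abs_le]
    constructor <;> nlinarith
  rw [meanChoose_succ_eq_scaledMoment (k := 2) hq hn, sigma_eq_pow_mul_divisorRatioSum hq,
    ArithmeticFunction.sigma_zero_apply, sigma_eq_pow_mul_divisorRatioSum hq, ← hDdef, pow_one]
  have e : (q : ℝ) ^ 2 * scaledMoment q 2 / ((2 + 1)! : ℝ) - 1 / 6 * (q ^ 2 * divisorRatioSum q 2) =
      q / 6 * (q * (scaledMoment q 2 - divisorRatioSum q 2)) := by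
    norm_num [Nat.factorial]
    ring
  rw [e, abs_mul, abs_of_pos (by positivity)]
  calc (q : ℝ) / 6 * |q * (scaledMoment q 2 - divisorRatioSum q 2)|
      ≤ q / 6 * (11 * (D * S)) := mul_le_mul_of_nonneg_left hbound (by positivity)
    _ ≤ 2 * (D * (q * S)) := by
      have : 0 ≤ q * (D * S) := by positivity
      linarith

theorem meanChoose_four_le {n q Δ : ℕ} (hq : 4096 * 100 ^ 6 ≤ q) (hΔ : 4 ≤ Δ) (hΔq : 2 ^ Δ ≤ q)
    (hn : Δ * q ≤ n) :
    |meanChoose n q Δ - 1 / (Δ ! : ℝ) * (ArithmeticFunction.sigma (Δ - 1) q : ℝ)| ≤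
      1000 * (1 / (Δ ! : ℝ) * (q : ℝ) ^ (Δ - 2) *
        ((Δ : ℝ) * (ArithmeticFunction.sigma 0 q : ℝ) + 2 ^ Δ)) := by
  have hqne : q ≠ 0 := by omega
  obtain ⟨m, rfl⟩ : ∃ m, Δ = m + 2 := ⟨Δ - 2, by omega⟩
  have h := abs_scaledMoment_sub_le (k := m + 1) hq (by omega) hΔq
  rw [meanChoose_succ_eq_scaledMoment hqne hn, show m + 2 - 1 = m + 1 from rfl,
    sigma_eq_pow_mul_divisorRatioSum hqne, ArithmeticFunction.sigma_zero_apply, Nat.add_sub_cancel]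
  have e : (q : ℝ) ^ (m + 1) * scaledMoment q (m + 1) / ((m + 1 + 1)! : ℝ) -
      1 / ((m + 2)! : ℝ) * (q ^ (m + 1) * divisorRatioSum q (m + 1)) =
      1 / ((m + 2)! : ℝ) * q ^ m *
        (q * (scaledMoment q (m + 1) - divisorRatioSum q (m + 1))) := by
    ring
  rw [e, abs_mul, abs_of_nonneg (by positivity), abs_mul, Nat.abs_cast]
  calc _ ≤ 1 / ((m + 2)! : ℝ) * q ^ m * _ := mul_le_mul_of_nonneg_left h (by positivity)
    _ = _ := by push_cast; ring

theorem two_pow_le_of_le_log {q Δ : ℕ} (hq : q ≠ 0) (h : (Δ : ℝ) ≤ Real.log q / Real.log 2) :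
    2 ^ Δ ≤ q := by
  have hq0 : (0 : ℝ) < q := by exact_mod_cast Nat.pos_of_ne_zero hq
  rw [le_div_iff₀ (Real.log_pos one_lt_two), ← Real.log_pow,
    Real.log_le_log_iff (by positivity) hq0] at h
  exact_mod_cast h

theorem mainTheorem2 :
    ∃ C : ℝ, 0 < C ∧ ∃ q₀ : ℕ, ∀ q : ℕ, q₀ ≤ q →
      ∀ Δ : ℕ, 1 ≤ Δ → (Δ : ℝ) ≤ Real.log q / Real.log 2 →
      ∀ n : ℕ, Δ * q ≤ n →
        (Δ = 1 → meanChoose n q Δ = (ArithmeticFunction.sigma 0 q : ℝ)) ∧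
        (Δ = 2 →
          |meanChoose n q Δ - 1 / 2 * (ArithmeticFunction.sigma 1 q : ℝ)|
            ≤ C * (ArithmeticFunction.sigma 0 q : ℝ) ^ 2) ∧
        (Δ = 3 →
          |meanChoose n q Δ - 1 / 6 * (ArithmeticFunction.sigma 2 q : ℝ)|
            ≤ C * ((ArithmeticFunction.sigma 0 q : ℝ) * (ArithmeticFunction.sigma 1 q : ℝ))) ∧
        (4 ≤ Δ →
          |meanChoose n q Δ - 1 / (Δ ! : ℝ) * (ArithmeticFunction.sigma (Δ - 1) q : ℝ)|
            ≤ C * (1 / (Δ ! : ℝ) * (q : ℝ) ^ (Δ - 2) *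
                ((Δ : ℝ) * (ArithmeticFunction.sigma 0 q : ℝ) + 2 ^ Δ))) := by

  refine ⟨1000, by norm_num, 4096 * 100 ^ 6, fun q hq Δ _ hΔlog n hn => ?_⟩
  have hqne : q ≠ 0 := by omega
  have hΔq := two_pow_le_of_le_log hqne hΔlog
  refine ⟨?_, ?_, ?_, fun hΔ => meanChoose_four_le hq hΔ hΔq hn⟩
  · rintro rfl
    exact meanChoose_one hqne hn
  · rintro rfl
    refine (meanChoose_two hqne hn).trans ?_
    exact le_mul_of_one_le_left (by positivity) (by norm_num)
  · rintro rfl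
    refine (meanChoose_three hqne hn).trans ?_
    exact mul_le_mul_of_nonneg_right (by norm_num) (by positivity)
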